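/- Call a real $n\times n$ matrix $\mathrm{gl}$-regular if its minimal polynomial equals its characteristic polynomial. Let $k_1,\dots,k_s$ be positive integers with $k_1+\dots+k_s=n$, and let the regular layer $W_{k_1,\dots,k_s}\subset \mathrm{gl}(n,\mathbb R)$ be the set of all $\mathrm{gl}$-regular real $n\times n$ matrices that have exactly $s$ distinct (real or complex) eigenvalues, with algebraic multiplicities $k_1,\dots,k_s$. Let $J_0$ be the nilpotent $n\times n$ Jordan block with ones on the superdiagonal. Then there exist an open neighbourhood $U$ of $0\in\mathbb R^n$ and a real analytic Nijenhuis operator $L$ on $U$, that is, a real analytic field of $n\times n$ matrices whose Nijenhuis torsion $$\mathcal N_L(\xi,\eta)=L^2[\xi,\eta]-L[L\xi,\eta]-L[\xi,L\eta]+[L\xi,L\eta]$$ vanishes for all smooth vector fields $\xi,\eta$ on $U$, such that 1. $L(0)=J_0$; 2. for every $x\in U$, $L(x)$ lies in the closure $\overline W_{k_1,\dots,k_s}$ of $W_{k_1,\dots,k_s}$, both in the usual topology and in the Zariski topology of $\mathrm{gl}(n,\mathbb R)$; 3. at a generic point $x$ of $U$, namely for all $x$ in an open dense subset of $U$, $L(x)$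 itself lies in $W_{k_1,\dots,k_s}$. -/

import Mathlib

open scoped Matrix ContDiff

/-- The Nijenhuis torsion
`N_L(ξ, η) = L² [ξ, η] - L [L ξ, η] - L [ξ, L η] + [L ξ, L η]` at the point `x`, for an operator
field `L` on `ℝⁿ` (given by its matrix in the standard coordinates) and vector fields `ξ`, `η`. -/
noncomputable def nijenhuisTorsion {n : ℕ} (L : (Fin n → ℝ) → Matrix (Fin n) (Fin n) ℝ)
    (ξ η : (Fin n → ℝ) → (Fin n → ℝ)) (x : Fin n → ℝ) : Fin n → ℝ :=
  L x *ᵥ (L x *ᵥ VectorField.lieBracket ℝ ξ η x)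
    - L x *ᵥ VectorField.lieBracket ℝ (fun y => L y *ᵥ ξ y) η x
    - L x *ᵥ VectorField.lieBracket ℝ ξ (fun y => L y *ᵥ η y) x
    + VectorField.lieBracket ℝ (fun y => L y *ᵥ ξ y) (fun y => L y *ᵥ η y) x

/-- `L` is a real analytic Nijenhuis operator on the open set `U ⊆ ℝⁿ`: its matrix entries are
real analytic on `U`, and its Nijenhuis torsion vanishes at every point of `U`, for all smooth
vector fields on `U`. -/
structure IsNijenhuisOn {n : ℕ} (L : (Fin n → ℝ) → Matrix (Fin n) (Fin n) ℝ)
    (U : Set (Fin n → ℝ)) : Prop where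
  isOpen : IsOpen U
  analytic : ∀ i j, AnalyticOnNhd ℝ (fun x => L x i j) U
  torsion_eq_zero : ∀ ξ η : (Fin n → ℝ) → (Fin n → ℝ),
    ContDiffOn ℝ ∞ ξ U → ContDiffOn ℝ ∞ η U → ∀ x ∈ U, nijenhuisTorsion L ξ η x = 0

/-- The nilpotent `n × n` Jordan block, with ones on the superdiagonal. -/
def nilpotentJordanBlock (n : ℕ) : Matrix (Fin n) (Fin n) ℝ :=
  Matrix.of fun i j => if (i : ℕ) + 1 = (j : ℕ) then 1 else 0

/-- A real matrix is `gl`-regular if its minimal and characteristic polynomials coincide. -/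
def IsGlRegular {n : ℕ} (A : Matrix (Fin n) (Fin n) ℝ) : Prop :=
  minpoly ℝ A = A.charpoly

/-- The regular layer `W_{k_1, …, k_s}`: the `gl`-regular real `n × n` matrices having exactly `s`
distinct (real or complex) eigenvalues, with algebraic multiplicities `k_1, …, k_s`. -/
def regularLayer (n : ℕ) {s : ℕ} (k : Fin s → ℕ) : Set (Matrix (Fin n) (Fin n) ℝ) :=
  {A | IsGlRegular A ∧ ∃ μ : Fin s → ℂ, Function.Injective μ ∧
    A.charpoly.map (algebraMap ℝ ℂ) = ∏ i, (Polynomial.X - Polynomial.C (μ i)) ^ k i}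

/-- The Zariski closure of a set of real matrices: the common zeros of all real polynomials in
the matrix entries that vanish on the set. -/
def zariskiClosure {n : ℕ} (S : Set (Matrix (Fin n) (Fin n) ℝ)) :
    Set (Matrix (Fin n) (Fin n) ℝ) :=
  {A | ∀ p : MvPolynomial (Fin n × Fin n) ℝ,
    (∀ B ∈ S, MvPolynomial.eval (fun e => B e.1 e.2) p = 0) →
      MvPolynomial.eval (fun e => A e.1 e.2) p = 0}

/-! Take `L = rowCompanion b`, a companion matrix with last row `b(x)`. It is automatically
`gl`-regular, and its characteristic polynomial is `monicOfTail b`. Its torsion vanishes once the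
form `⟨Db a, c⟩` is symmetric and `L` is self-adjoint for it (`nijenhuisTorsion_rowCompanion`), so
it remains to choose `b`.

Let `A` be an `n`-dimensional commutative algebra with characters `χ i` such that `∏ (Y - χ i Y) ^ k
i = 0` for every `Y`. Use `ℓ (Y ^ (1 - 2 e)) / (1 - 2 e)`, `0 ≤ e < n`, as coordinates on units `Y`,
and let `b` be the tail of `∏ (X - χ i (Y ^ 2)) ^ k i`. In these coordinates `L` acts as
multiplication by `Y ^ 2` and `⟨Db a, c⟩` becomes `ℓ (M · dY a · dY c)`, so commutativity of `A`
gives both conditions (`exists_derivForm_eq`).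

The coordinates are weighted homogeneous in `Y`. Writing `Y = v • Φ (blowUp y)`, with `v` the last
coordinate and `Φ` a local inverse of the coordinate map near a unit `t`, extends `Y` analytically
across `v = 0`, with `Y = 0` and hence `L = J₀` at the origin. Where `v ≠ 0` the eigenvalues `χ i
(Y) ^ 2` are distinct; the rest follows by density (`exists_nijenhuis_of_algebra`). A suitable `A`
is `ℝ[X] / ∏ (X - (i + 1)) ^ k i`, with `t` the class of `X`. -/

/-! ### Companion matrices -/

open Polynomial in
/-- The monic polynomial `X ^ n - ∑ j, b j * X ^ j`. -/
noncomputable def monicOfTail {n : ℕ} (b : Fin n → ℝ) : ℝ[X] :=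
  X ^ n - ∑ j, C (b j) * X ^ (j : ℕ)

/-- The last vector of the standard basis (zero when `n = 0`). -/
def lastVec (n : ℕ) : Fin n → ℝ := fun i => if (i : ℕ) + 1 = n then 1 else 0

/-- The companion matrix with ones on the superdiagonal and last row `b`. -/
def rowCompanion {n : ℕ} (b : Fin n → ℝ) : Matrix (Fin n) (Fin n) ℝ :=
  nilpotentJordanBlock n + Matrix.vecMulVec (lastVec n) b

theorem rowCompanion_apply {n : ℕ} (b : Fin n → ℝ) (i j : Fin n) :
    rowCompanion b i j =
      (if (i : ℕ) + 1 = (j : ℕ) then 1 else 0) + (if (i : ℕ) + 1 = n then b j else 0) := by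
  simp [rowCompanion, nilpotentJordanBlock, Matrix.vecMulVec_apply, lastVec]

theorem rowCompanion_zero (n : ℕ) :
    rowCompanion (0 : Fin n → ℝ) = nilpotentJordanBlock n := by
  ext i j; simp [rowCompanion_apply, nilpotentJordanBlock]

theorem rowCompanion_mulVec {n : ℕ} (b u : Fin n → ℝ) :
    rowCompanion b *ᵥ u = nilpotentJordanBlock n *ᵥ u + (b ⬝ᵥ u) • lastVec n := by
  rw [rowCompanion, Matrix.add_mulVec, Matrix.vecMulVec_mulVec]
  ext i; simp

theorem rowCompanion_mulVec_apply_of_lt {n : ℕ} (b u : Fin n → ℝ) (i : Fin n)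
    (h : (i : ℕ) + 1 < n) : (rowCompanion b *ᵥ u) i = u ⟨i + 1, h⟩ := by
  have h1 : (i : ℕ) + 1 ≠ n := h.ne
  rw [Matrix.mulVec, dotProduct, Finset.sum_eq_single ⟨(i : ℕ) + 1, h⟩]
  · simp [rowCompanion_apply, h1]
  · intro j _ hj
    have : (i : ℕ) + 1 ≠ j := fun e => hj (Fin.ext e.symm)
    simp [rowCompanion_apply, h1, this]
  · simp

theorem rowCompanion_mulVec_apply_of_eq {n : ℕ} (b u : Fin n → ℝ) (i : Fin n)
    (h : (i : ℕ) + 1 = n) : (rowCompanion b *ᵥ u) i = b ⬝ᵥ u := by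
  rw [Matrix.mulVec, dotProduct, dotProduct]
  refine Finset.sum_congr rfl fun j _ => ?_
  have : n ≠ j := j.2.ne'
  simp [rowCompanion_apply, h, this]

theorem rowCompanion_row_of_lt {n : ℕ} (b : Fin n → ℝ) (i : ℕ) (h : i + 1 < n) :
    rowCompanion b ⟨i, by omega⟩ = Pi.single ⟨i + 1, h⟩ 1 := by
  ext j
  have h1 : i + 1 ≠ n := h.ne
  simp only [rowCompanion_apply, h1, if_false, add_zero, Pi.single_apply, Fin.ext_iff]
  exact if_congr eq_comm rfl rfl

theorem rowCompanion_row_last {n : ℕ} (b : Fin (n + 1) → ℝ) :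
    rowCompanion b (Fin.last n) = b := by
  ext j
  have : n + 1 ≠ j := by have := j.2; omega
  simp [rowCompanion_apply, this]

/-- The first basis row vector is cyclic. Hence row `0` of `q(M)` lists the coefficients of `q` when
`deg q < n`, so no nonzero polynomial of smaller degree kills `M`. -/
theorem rowCompanion_pow_row {n : ℕ} (b : Fin n → ℝ) (i : ℕ) (h : i < n) :
    (rowCompanion b ^ i) ⟨0, by omega⟩ = Pi.single ⟨i, h⟩ 1 := by
  induction i with
  | zero => ext j; simp [Matrix.one_apply, Pi.single_apply, eq_comm]
  | succ i ih =>
    rw [pow_succ, Matrix.mul_apply_eq_vecMul, ih (by omega), Matrix.single_one_vecMul]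
    exact rowCompanion_row_of_lt b i h

/-! ### Minimal and characteristic polynomials of companion matrices -/

section
open Polynomial

theorem monicOfTail_degree_tail {n : ℕ} (b : Fin n → ℝ) :
    (∑ j, C (b j) * X ^ (j : ℕ)).degree < (n : WithBot ℕ) := by
  refine lt_of_le_of_lt (degree_sum_le _ _) ?_
  refine (Finset.sup_lt_iff (WithBot.bot_lt_coe n)).2 fun j _ => ?_
  exact lt_of_le_of_lt (degree_C_mul_X_pow_le _ _) (WithBot.coe_lt_coe.2 j.2)

theorem monicOfTail_natDegree_tail {n : ℕ} (b : Fin (n + 1) → ℝ) :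
    (∑ j, C (b j) * X ^ (j : ℕ)).natDegree < n + 1 := by
  by_cases h : (∑ j, C (b j) * X ^ (j : ℕ)) = 0
  · simp [h]
  · exact (natDegree_lt_iff_degree_lt h).2 (monicOfTail_degree_tail b)

theorem monicOfTail_monic {n : ℕ} (b : Fin n → ℝ) : (monicOfTail b).Monic :=
  monic_X_pow_sub (monicOfTail_degree_tail b)

theorem monicOfTail_natDegree {n : ℕ} (b : Fin n → ℝ) : (monicOfTail b).natDegree = n := by
  refine natDegree_eq_of_degree_eq_some ?_
  rw [monicOfTail, degree_sub_eq_left_of_degree_lt] <;> rw [degree_X_pow]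
  exact monicOfTail_degree_tail b

theorem monicOfTail_neg_coeff {n : ℕ} {p : ℝ[X]} (hp : p.Monic) (hn : p.natDegree = n) :
    monicOfTail (fun j : Fin n => -p.coeff j) = p := by
  subst hn
  conv_rhs => rw [hp.as_sum]
  rw [monicOfTail, Fin.sum_univ_eq_sum_range (fun j => C (-p.coeff j) * X ^ j)]
  simp

theorem aeval_rowCompanion_row {n : ℕ} (b : Fin n → ℝ) (q : ℝ[X]) (hq : q.natDegree < n)
    (j : Fin n) : aeval (rowCompanion b) q ⟨0, by omega⟩ j = q.coeff j := by
  rw [aeval_eq_sum_range' hq, Matrix.sum_apply, Finset.sum_eq_single (j : ℕ)]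
  · rw [Matrix.smul_apply, rowCompanion_pow_row b j j.2]; simp
  · intro i hi hij
    rw [Matrix.smul_apply, rowCompanion_pow_row b i (Finset.mem_range.1 hi)]
    have : j ≠ ⟨i, Finset.mem_range.1 hi⟩ := fun e => hij (by rw [e])
    simp [this]
  · intro h; exact absurd (Finset.mem_range.2 j.2) h

theorem aeval_rowCompanion_monicOfTail {n : ℕ} (b : Fin n → ℝ) :
    aeval (rowCompanion b) (monicOfTail b) = 0 := by
  rcases n with _ | n
  · exact Subsingleton.elim _ _
  set M := rowCompanion b
  have h0 : aeval M (monicOfTail b) 0 = 0 := by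
    have h1 : (M ^ (n + 1)) 0 = b := by
      have := rowCompanion_pow_row b n (by omega)
      rw [pow_succ, Matrix.mul_apply_eq_vecMul]
      erw [this]
      rw [Matrix.single_one_vecMul]
      exact rowCompanion_row_last b
    rw [monicOfTail]
    ext j
    have h2 : aeval M (∑ j, C (b j) * X ^ (j : ℕ)) 0 j = b j := by
      have := aeval_rowCompanion_row b (∑ j, C (b j) * X ^ (j : ℕ))
        (monicOfTail_natDegree_tail b) j
      rw [finsetSum_coeff] at this
      simpa [coeff_C_mul, coeff_X_pow, Fin.val_inj] using this
    rw [map_sub, Matrix.sub_apply, h2, map_pow, aeval_X, h1]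
    simp
  ext i j
  -- Row `i` of `p(M)` is `e₀ Mⁱ p(M) = e₀ p(M) Mⁱ`, so the vanishing of row `0` suffices.
  have h3 : (M ^ (i : ℕ) * aeval M (monicOfTail b)) 0 = aeval M (monicOfTail b) i := by
    rw [Matrix.mul_apply_eq_vecMul]
    erw [rowCompanion_pow_row b i i.2]
    rw [Matrix.single_one_vecMul]; rfl
  have h4 : M ^ (i : ℕ) * aeval M (monicOfTail b) = aeval M (monicOfTail b) * M ^ (i : ℕ) := by
    have : M ^ (i : ℕ) = aeval M (X ^ (i : ℕ) : ℝ[X]) := by simp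
    rw [this, ← map_mul, ← map_mul, mul_comm]
  rw [← h3, h4, Matrix.mul_apply_eq_vecMul, h0]
  simp

theorem natDegree_of_aeval_rowCompanion_eq_zero {n : ℕ} (b : Fin n → ℝ) (q : ℝ[X]) (hq : q.Monic)
    (h : aeval (rowCompanion b) q = 0) : n ≤ q.natDegree := by
  by_contra! hlt
  have := aeval_rowCompanion_row b q hlt ⟨_, hlt⟩
  rw [h] at this
  simp [hq.leadingCoeff] at this

theorem minpoly_rowCompanion {n : ℕ} (b : Fin n → ℝ) :
    minpoly ℝ (rowCompanion b) = monicOfTail b := by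
  symm
  refine minpoly.unique ℝ _ (monicOfTail_monic b) (aeval_rowCompanion_monicOfTail b) ?_
  intro q hq h
  rw [degree_eq_natDegree (monicOfTail_monic b).ne_zero, degree_eq_natDegree hq.ne_zero,
    monicOfTail_natDegree]
  exact_mod_cast natDegree_of_aeval_rowCompanion_eq_zero b q hq h

theorem charpoly_rowCompanion {n : ℕ} (b : Fin n → ℝ) :
    (rowCompanion b).charpoly = monicOfTail b := by
  have h := Matrix.minpoly_dvd_charpoly (rowCompanion b)
  rw [minpoly_rowCompanion] at h
  refine eq_of_monic_of_dvd_of_natDegree_le (monicOfTail_monic b)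
    (Matrix.charpoly_monic _) h ?_
  rw [monicOfTail_natDegree, Matrix.charpoly_natDegree_eq_dim, Fintype.card_fin]

theorem rowCompanion_mem_regularLayer {n s : ℕ} (k : Fin s → ℕ) (b : Fin n → ℝ) (μ : Fin s → ℝ)
    (hμ : Function.Injective μ) (h : monicOfTail b = ∏ i, (X - C (μ i)) ^ k i) :
    rowCompanion b ∈ regularLayer n k := by
  refine ⟨?_, fun i => (μ i : ℂ), fun i j hij => hμ (by simpa using hij), ?_⟩
  · rw [IsGlRegular, minpoly_rowCompanion, charpoly_rowCompanion]
  · rw [charpoly_rowCompanion, h]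
    simp [Polynomial.map_prod]

end

theorem closure_subset_zariskiClosure {n : ℕ} (S : Set (Matrix (Fin n) (Fin n) ℝ)) :
    closure S ⊆ zariskiClosure S := by
  intro A hA p hp
  have hc : Continuous fun B : Matrix (Fin n) (Fin n) ℝ =>
      MvPolynomial.eval (fun e : Fin n × Fin n => B e.1 e.2) p := by
    refine (MvPolynomial.continuous_eval p).comp (continuous_pi fun e => ?_)
    exact continuous_id.matrix_elem e.1 e.2
  exact (isClosed_eq hc continuous_const).closure_subset_iff.2 hp hA

/-! ### The torsion of a companion operator -/

/-- The bilinear form `(a, c) ↦ ⟨Db(x) a, c⟩`. -/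
noncomputable def derivForm {n : ℕ} (b : (Fin n → ℝ) → Fin n → ℝ) (x a c : Fin n → ℝ) : ℝ :=
  fderiv ℝ b x a ⬝ᵥ c

theorem fderiv_rowCompanion_mulVec {n : ℕ} {b ξ : (Fin n → ℝ) → Fin n → ℝ} {x : Fin n → ℝ}
    (hb : DifferentiableAt ℝ b x) (hξ : DifferentiableAt ℝ ξ x) :
    DifferentiableAt ℝ (fun y => rowCompanion (b y) *ᵥ ξ y) x ∧
    ∀ h, fderiv ℝ (fun y => rowCompanion (b y) *ᵥ ξ y) x h =
      rowCompanion (b x) *ᵥ fderiv ℝ ξ x h + derivForm b x h (ξ x) • lastVec n := by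
  have h1 : HasFDerivAt (fun y => nilpotentJordanBlock n *ᵥ ξ y)
      ((Matrix.mulVecLin (nilpotentJordanBlock n)).toContinuousLinearMap.comp (fderiv ℝ ξ x)) x :=
    (Matrix.mulVecLin (nilpotentJordanBlock n)).toContinuousLinearMap.hasFDerivAt.comp x
      hξ.hasFDerivAt
  have h2 : HasFDerivAt (fun y => b y ⬝ᵥ ξ y)
      (∑ j, (b x j • (ContinuousLinearMap.proj (R := ℝ) (φ := fun _ : Fin n => ℝ) j).comp
          (fderiv ℝ ξ x) +
        ξ x j • (ContinuousLinearMap.proj (R := ℝ) (φ := fun _ : Fin n => ℝ) j).comp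
          (fderiv ℝ b x))) x := by
    unfold dotProduct
    refine HasFDerivAt.fun_sum fun j _ => ?_
    exact (hasFDerivAt_pi'.1 hb.hasFDerivAt j).mul (hasFDerivAt_pi'.1 hξ.hasFDerivAt j)
  have h3 := h1.add (h2.smul_const (lastVec n))
  have h4 : (fun y => rowCompanion (b y) *ᵥ ξ y) =
      (fun y => nilpotentJordanBlock n *ᵥ ξ y) + fun y => (b y ⬝ᵥ ξ y) • lastVec n := by
    ext1 y; exact rowCompanion_mulVec _ _
  rw [h4]
  refine ⟨h3.differentiableAt, fun h => ?_⟩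
  rw [h3.fderiv, rowCompanion_mulVec, add_assoc, ← add_smul]
  simp only [add_apply, ContinuousLinearMap.comp_apply,
    ContinuousLinearMap.smulRight_apply, LinearMap.coe_toContinuousLinearMap',
    Matrix.mulVecLin_apply]
  congr 2
  rw [sum_apply, derivForm, dotProduct, dotProduct, ← Finset.sum_add_distrib]
  refine Finset.sum_congr rfl fun j _ => ?_
  simp [mul_comm]

/-- By the Leibniz rule all derivatives of `ξ` and `η` cancel. What remains is a multiple of `L
(lastVec n)`, killed by `hs`, and a multiple of `lastVec n`, killed by `hL`. -/
theorem nijenhuisTorsion_rowCompanion {n : ℕ} {b ξ η : (Fin n → ℝ) → Fin n → ℝ} {x : Fin n → ℝ}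
    (hb : DifferentiableAt ℝ b x) (hξ : DifferentiableAt ℝ ξ x) (hη : DifferentiableAt ℝ η x)
    (hs : ∀ a c, derivForm b x a c = derivForm b x c a)
    (hL : ∀ a c, derivForm b x (rowCompanion (b x) *ᵥ a) c =
      derivForm b x (rowCompanion (b x) *ᵥ c) a) :
    nijenhuisTorsion (fun y => rowCompanion (b y)) ξ η x = 0 := by
  have e1 := (fderiv_rowCompanion_mulVec hb hξ).2
  have e2 := (fderiv_rowCompanion_mulVec hb hη).2
  simp only [nijenhuisTorsion, VectorField.lieBracket_eq, e1, e2, Matrix.mulVec_sub,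
    Matrix.mulVec_add, Matrix.mulVec_smul]
  rw [hs (η x) (ξ x), hL (η x) (ξ x)]
  abel

/-! ### Power coordinates on the units of a commutative algebra -/

section
open Topology

variable {A : Type*} [NormedCommRing A] [NormedAlgebra ℝ A]

theorem ringInverse_eq_of_mul_eq_one {R : Type*} [CommRing R] {x y : R} (h : x * y = 1) :
    Ring.inverse x = y :=
  Ring.inverse_unit (⟨x, y, h, by rw [mul_comm, h]⟩ : Rˣ)

/-- The functions `W ↦ ℓ (W ^ (1 - 2 * e)) / (1 - 2 * e)` with `e = n - 1, …, 0`. -/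
noncomputable def powerCoord (ℓ : A →L[ℝ] ℝ) (n : ℕ) (W : A) : Fin n → ℝ := fun j =>
  (1 - (2 * (n - (j + 1)) : ℕ) : ℝ)⁻¹ * ℓ (W * Ring.inverse W ^ (2 * (n - (j + 1))))

/-- Parity is why the eigenvalue operator is `Y ^ 2` and not `Y`: no exponent is zero, so
integrating `Y ^ (-2 e) dY` never produces a logarithm. -/
theorem one_sub_two_mul_ne_zero (e : ℕ) : (1 - (2 * e : ℕ) : ℝ) ≠ 0 := by
  rw [sub_ne_zero]
  have : 1 ≠ 2 * e := by omega
  exact_mod_cast this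

theorem hasFDerivAt_mul_ringInverse_pow [CompleteSpace A] {W : A} (hW : IsUnit W) (k : ℕ) :
    HasFDerivAt (fun W : A => W * Ring.inverse W ^ k)
      ((1 - (k : ℝ)) • ContinuousLinearMap.mul ℝ A (Ring.inverse W ^ k)) W := by
  obtain ⟨t, rfl⟩ := hW
  have h := (hasFDerivAt_id (𝕜 := ℝ) (t : A)).mul ((hasFDerivAt_ringInverse (𝕜 := ℝ) t).pow k)
  refine h.congr_fderiv ?_
  ext u
  rcases k with _ | k
  · simp
  · have e : (t : A) * (↑t⁻¹ : A) = 1 := t.mul_inv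
    simp [Algebra.smul_def]
    linear_combination (-(k + 1 : A) * (↑t⁻¹ : A) ^ (k + 1) * u) * e

theorem hasFDerivAt_powerCoord [CompleteSpace A] (ℓ : A →L[ℝ] ℝ) (n : ℕ) {W : A} (hW : IsUnit W) :
    HasFDerivAt (powerCoord ℓ n) (ContinuousLinearMap.pi fun j : Fin n =>
      ℓ.comp (ContinuousLinearMap.mul ℝ A (Ring.inverse W ^ (2 * (n - (j + 1)))))) W := by
  rw [hasFDerivAt_pi]
  intro j
  have h := (ℓ.hasFDerivAt.comp W
    (hasFDerivAt_mul_ringInverse_pow hW (2 * (n - (j + 1))))).const_mul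
    ((1 - (2 * (n - (j + 1)) : ℕ) : ℝ)⁻¹)
  refine h.congr_fderiv ?_
  ext u
  have := one_sub_two_mul_ne_zero (n - (j + 1))
  simp only [ContinuousLinearMap.comp_smul, smul_smul, inv_mul_cancel₀ this, one_smul]

theorem analyticAt_powerCoord [CompleteSpace A] (ℓ : A →L[ℝ] ℝ) (n : ℕ) {W : A} (hW : IsUnit W) :
    AnalyticAt ℝ (powerCoord ℓ n) W := by
  obtain ⟨t, rfl⟩ := hW
  refine AnalyticAt.pi fun j => ?_
  refine analyticAt_const.mul (AnalyticAt.comp (ℓ.analyticAt _) ?_)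
  exact analyticAt_id.mul ((analyticAt_inverse t).pow _)

/-- Coordinate `j` has weight `1 - 2 e` with `e = n - (j + 1)`; the factor `v ^ (2 e)` is moved to
the left to avoid negative powers. -/
theorem powerCoord_smul (ℓ : A →L[ℝ] ℝ) (n : ℕ) {v : ℝ} (hv : v ≠ 0) {W : A} (hW : IsUnit W)
    (j : Fin n) : v ^ (2 * (n - ((j : ℕ) + 1))) * powerCoord ℓ n (v • W) j =
      v * powerCoord ℓ n W j := by
  obtain ⟨t, rfl⟩ := hW
  have e : Ring.inverse (v • (t : A)) = v⁻¹ • (↑t⁻¹ : A) := by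
    refine ringInverse_eq_of_mul_eq_one ?_
    rw [smul_mul_smul_comm, mul_inv_cancel₀ hv, t.mul_inv, one_smul]
  simp only [powerCoord, e, Ring.inverse_unit, smul_pow, smul_mul_smul_comm, map_smul, smul_eq_mul]
  have : v ^ (2 * (n - ((j : ℕ) + 1))) * v⁻¹ ^ (2 * (n - ((j : ℕ) + 1))) = 1 := by
    rw [← mul_pow, mul_inv_cancel₀ hv, one_pow]
  linear_combination (v * (1 - (2 * (n - ((j : ℕ) + 1)) : ℕ) : ℝ)⁻¹ *
    ℓ (t * (↑t⁻¹ : A) ^ (2 * (n - ((j : ℕ) + 1))))) * this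

theorem exists_analyticAt_inverse_powerCoord [FiniteDimensional ℝ A] (ℓ : A →L[ℝ] ℝ) (n : ℕ)
    {t : A} (ht : IsUnit t)
    (hbij : Function.Bijective fun (u : A) (j : Fin n) =>
      ℓ (Ring.inverse t ^ (2 * (n - ((j : ℕ) + 1))) * u)) :
    ∃ Φ : (Fin n → ℝ) → A, AnalyticAt ℝ Φ (powerCoord ℓ n t) ∧ Φ (powerCoord ℓ n t) = t ∧
      ∀ᶠ w in 𝓝 (powerCoord ℓ n t), powerCoord ℓ n (Φ w) = w := by
  have : CompleteSpace A := FiniteDimensional.complete ℝ A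
  set D := ContinuousLinearMap.pi fun j : Fin n =>
      ℓ.comp (ContinuousLinearMap.mul ℝ A (Ring.inverse t ^ (2 * (n - (j + 1))))) with hD
  let E : A ≃L[ℝ] (Fin n → ℝ) :=
    (LinearEquiv.ofBijective (D : A →ₗ[ℝ] (Fin n → ℝ)) hbij).toContinuousLinearEquiv
  have hE : (E : A →L[ℝ] (Fin n → ℝ)) = D := by ext u; rfl
  have ha := analyticAt_powerCoord ℓ n ht
  have hd : HasFDerivAt (powerCoord ℓ n) (E : A →L[ℝ] (Fin n → ℝ)) t := by
    rw [hE]; exact hasFDerivAt_powerCoord ℓ n ht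
  have hs : HasStrictFDerivAt (powerCoord ℓ n) (E : A →L[ℝ] (Fin n → ℝ)) t := by
    rw [← hd.fderiv]; exact ha.hasStrictFDerivAt
  refine ⟨hs.localInverse _ _ _, ?_, hs.localInverse_apply_image, hs.eventually_right_inverse⟩
  exact ((hs.toOpenPartialHomeomorph _).contDiffAt_symm (n := ω) (f₀' := E)
    hs.image_mem_toOpenPartialHomeomorph_target
    (by rw [← hs.localInverse_def, hs.localInverse_apply_image]; exact hd)
    (by rw [← hs.localInverse_def, hs.localInverse_apply_image]; exact ha.contDiffAt)).analyticAt

theorem sum_mul_apply_inverse_pow {n : ℕ} (ℓ : A →L[ℝ] ℝ) {Y : A} (hY : IsUnit Y) (d : Fin n → ℝ)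
    (u : A) :
    ∑ j : Fin n, d j * ℓ (Ring.inverse Y ^ (2 * (n - ((j : ℕ) + 1))) * u) =
      ℓ (Ring.inverse Y ^ (2 * (n - 1)) * (∑ j : Fin n, d j • (Y ^ 2) ^ (j : ℕ)) * u) := by
  obtain ⟨t, rfl⟩ := hY
  rw [Finset.mul_sum, Finset.sum_mul, map_sum]
  refine Finset.sum_congr rfl fun j _ => ?_
  rw [mul_smul_comm, smul_mul_assoc, map_smul, smul_eq_mul, Ring.inverse_unit]
  have h1 : n - 1 = (n - ((j : ℕ) + 1)) + j := by have := j.2; omega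
  have h2 : ((↑t⁻¹ : A) ^ 2) ^ (j : ℕ) * ((t : A) ^ 2) ^ (j : ℕ) = 1 := by
    rw [← mul_pow, ← mul_pow, t.inv_mul]; simp
  congr 2
  rw [h1, mul_add, pow_add, pow_mul _ 2 (j : ℕ), mul_assoc (_ ^ _), h2, mul_one]

open Polynomial in
theorem aeval_monicOfTail {n : ℕ} (b : Fin n → ℝ) (x : A) :
    aeval x (monicOfTail b) = x ^ n - ∑ j, b j • x ^ (j : ℕ) := by
  simp [monicOfTail, Algebra.smul_def]

open Polynomial in
-- Differentiating the coordinates gives `a j = ℓ (Y ^ (-2 e) · dY a)`, and differentiating the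
-- polynomial relation for `Y ^ 2` gives `∑ db_j(a) Y ^ (2 j) = G · dY a`. Pairing the two yields `M
-- = Y ^ (-2 (n - 1)) G`.
theorem exists_derivForm_eq [CompleteSpace A] {n : ℕ} {ℓ : A →L[ℝ] ℝ} {Y : (Fin n → ℝ) → A}
    {b : (Fin n → ℝ) → Fin n → ℝ} {x : Fin n → ℝ} (hY : DifferentiableAt ℝ Y x)
    (hu : IsUnit (Y x)) (hF : ∀ᶠ y in 𝓝 x, powerCoord ℓ n (Y y) = y)
    (hb : DifferentiableAt ℝ b x)
    (hr : ∀ᶠ y in 𝓝 x, aeval (Y y ^ 2) (monicOfTail (b y)) = 0) :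
    ∃ M : A, ∀ a c, derivForm b x a c = ℓ (M * fderiv ℝ Y x a * fderiv ℝ Y x c) ∧
      derivForm b x a (rowCompanion (b x) *ᵥ c) =
        ℓ (M * fderiv ℝ Y x a * (Y x ^ 2 * fderiv ℝ Y x c)) := by
  have hcoord : ∀ (a : Fin n → ℝ) (j : Fin n),
      a j = ℓ (Ring.inverse (Y x) ^ (2 * (n - ((j : ℕ) + 1))) * fderiv ℝ Y x a) := by
    intro a j
    have h1 := (hasFDerivAt_powerCoord ℓ n hu).comp x hY.hasFDerivAt
    have h2 : HasFDerivAt (powerCoord ℓ n ∘ Y) (ContinuousLinearMap.id ℝ _) x :=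
      (hasFDerivAt_id x).congr_of_eventuallyEq hF
    have := congrArg (fun T => T a j) (h2.unique h1)
    simpa using this
  obtain ⟨G, hG⟩ : ∃ G : A, ∀ a,
      ∑ j : Fin n, fderiv ℝ b x a j • (Y x ^ 2) ^ (j : ℕ) = G * fderiv ℝ Y x a := by
    have hp : ∀ k : ℕ, HasFDerivAt (fun y => (Y y ^ 2) ^ k)
        (((2 * k : ℕ) • Y x ^ (2 * k - 1)) • fderiv ℝ Y x) x := by
      intro k
      simp only [← pow_mul]
      exact hY.hasFDerivAt.pow (2 * k)
    have h1 := (hp n).fun_sub (HasFDerivAt.fun_sum (u := Finset.univ) fun (j : Fin n) _ =>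
      (hasFDerivAt_pi'.1 hb.hasFDerivAt j).fun_smul (hp j))
    have h2 : HasFDerivAt (fun y => (Y y ^ 2) ^ n - ∑ j, b y j • (Y y ^ 2) ^ (j : ℕ))
        (0 : (Fin n → ℝ) →L[ℝ] A) x := by
      refine (hasFDerivAt_const (0 : A) x).congr_of_eventuallyEq ?_
      filter_upwards [hr] with y hy
      rw [← aeval_monicOfTail, hy]
    -- `G` is the derivative in `Y` of `Y ^ (2 n) - ∑ b_j Y ^ (2 j)` with `b` frozen.
    refine ⟨(2 * n : ℕ) • Y x ^ (2 * n - 1) -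
      ∑ j : Fin n, b x j • ((2 * (j : ℕ) : ℕ) • Y x ^ (2 * (j : ℕ) - 1)), fun a => ?_⟩
    have h3 := congrArg (fun T => T a) (h1.unique h2)
    simp only [sub_apply, sum_apply, add_apply, smul_apply,
      ContinuousLinearMap.smulRight_apply, ContinuousLinearMap.comp_apply,
      ContinuousLinearMap.proj_apply, Finset.sum_add_distrib, zero_apply,
      smul_eq_mul] at h3
    rw [sub_mul, Finset.sum_mul]
    simp only [smul_mul_assoc] at h3 ⊢
    linear_combination -h3
  have hform : ∀ (a c : Fin n → ℝ) (u : A),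
      (∀ j : Fin n, c j = ℓ (Ring.inverse (Y x) ^ (2 * (n - ((j : ℕ) + 1))) * u)) →
      derivForm b x a c =
        ℓ (Ring.inverse (Y x) ^ (2 * (n - 1)) * G * fderiv ℝ Y x a * u) := by
    intro a c u hc
    rw [derivForm, dotProduct]
    simp only [hc]
    rw [sum_mul_apply_inverse_pow ℓ hu, hG, ← mul_assoc]
  refine ⟨Ring.inverse (Y x) ^ (2 * (n - 1)) * G, fun a c =>
    ⟨hform a c _ (hcoord c), hform a _ _ fun j => ?_⟩⟩
  have hinv : Ring.inverse (Y x) * Y x = 1 := Ring.inverse_mul_cancel _ hu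
  -- The components of `L c` are those attached to `u = Y ^ 2 · dY c`: the shift lowers `e` by one,
  -- and the last row uses `∑ b_j Y ^ (2 j) = Y ^ (2 n)`.
  rcases Nat.lt_or_ge (j + 1) n with hj | hj
  · rw [rowCompanion_mulVec_apply_of_lt _ _ _ hj, hcoord c]
    have : n - ((j : ℕ) + 1) = (n - (j + 1 + 1)) + 1 := by omega
    rw [this, mul_add, pow_add, ← mul_assoc, mul_assoc (_ ^ _), mul_one, ← mul_pow, hinv,
      one_pow, mul_one]
  · have hj : (j : ℕ) + 1 = n := by have := j.2; omega
    rw [rowCompanion_mulVec_apply_of_eq _ _ _ hj, dotProduct]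
    simp only [hcoord c]
    rw [sum_mul_apply_inverse_pow ℓ hu, hj]
    have h0 := hr.self_of_nhds
    rw [aeval_monicOfTail, sub_eq_zero] at h0
    have : ((Y x) ^ 2) ^ n = Y x ^ (2 * (n - 1)) * Y x ^ 2 := by
      rw [← pow_mul, ← pow_add]; congr 1; omega
    rw [← h0, this, ← mul_assoc, ← mul_pow, hinv]
    simp

end

/-! ### Analytic dependence of polynomial coefficients on the roots -/

section
open Polynomial

theorem analyticOnNhd_coeff_mul {E : Type*} [NormedAddCommGroup E] [NormedSpace ℝ E] {U : Set E}
    {P Q : E → ℝ[X]} (hP : ∀ j, AnalyticOnNhd ℝ (fun y => (P y).coeff j) U)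
    (hQ : ∀ j, AnalyticOnNhd ℝ (fun y => (Q y).coeff j) U) (j : ℕ) :
    AnalyticOnNhd ℝ (fun y => (P y * Q y).coeff j) U := by
  simp only [coeff_mul]
  exact Finset.analyticOnNhd_fun_sum _ fun i _ => (hP i.1).mul (hQ i.2)

theorem analyticOnNhd_coeff_prod {E ι : Type*} [NormedAddCommGroup E] [NormedSpace ℝ E] {U : Set E}
    {P : ι → E → ℝ[X]} (hP : ∀ i j, AnalyticOnNhd ℝ (fun y => (P i y).coeff j) U)
    (s : Finset ι) (j : ℕ) : AnalyticOnNhd ℝ (fun y => (∏ i ∈ s, P i y).coeff j) U := by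
  classical
  induction s using Finset.induction_on generalizing j with
  | empty => simpa using analyticOnNhd_const
  | insert i s hi ih =>
    simp only [Finset.prod_insert hi]
    exact analyticOnNhd_coeff_mul (hP i) ih j

theorem analyticOnNhd_coeff_prod_X_sub_C_pow {E ι : Type*} [NormedAddCommGroup E]
    [NormedSpace ℝ E] {U : Set E} [Fintype ι] {lam : ι → E → ℝ}
    (h : ∀ i, AnalyticOnNhd ℝ (lam i) U) (k : ι → ℕ) (j : ℕ) :
    AnalyticOnNhd ℝ (fun y => (∏ i, (X - C (lam i y)) ^ k i).coeff j) U := by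
  refine analyticOnNhd_coeff_prod (fun i j => ?_) _ j
  have h1 : ∀ j, AnalyticOnNhd ℝ (fun y => (X - C (lam i y)).coeff j) U := by
    intro j
    simp only [coeff_sub, coeff_C, coeff_X]
    refine analyticOnNhd_const.sub ?_
    split_ifs
    · exact h i
    · exact analyticOnNhd_const
  have := analyticOnNhd_coeff_prod (fun (_ : Fin (k i)) => h1) Finset.univ j
  simpa using this

end

/-! ### Weighted blow-up and extension across the degenerate hyperplane -/

section
open Topology Polynomial

/-- The weighted blow-up `y ↦ (v ^ (2 e_j - 1) * y_j)_j`, with `v` the last coordinate, `e_j = n - j`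
for `j : Fin (n + 1)`, and last component `1`. -/
noncomputable def blowUp (n : ℕ) (y : Fin (n + 1) → ℝ) : Fin (n + 1) → ℝ := fun j =>
  if j = Fin.last n then 1 else y (Fin.last n) ^ (2 * (n - j) - 1) * y j

theorem blowUp_zero (n : ℕ) : blowUp n 0 = Pi.single (Fin.last n) 1 := by
  ext j
  by_cases h : j = Fin.last n <;> simp [blowUp, h]

theorem analyticAt_blowUp (n : ℕ) (y : Fin (n + 1) → ℝ) : AnalyticAt ℝ (blowUp n) y := by
  refine AnalyticAt.pi fun j => ?_
  have hp : ∀ i, AnalyticAt ℝ (fun y : Fin (n + 1) → ℝ => y i) y := fun i =>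
    (ContinuousLinearMap.proj (R := ℝ) (φ := fun _ : Fin (n + 1) => ℝ) i).analyticAt y
  by_cases h : j = Fin.last n
  · simpa [blowUp, h] using analyticAt_const
  · simp only [blowUp, if_neg h]
    exact ((hp _).fun_pow _).fun_mul (hp j)

theorem mul_blowUp (n : ℕ) (y : Fin (n + 1) → ℝ) (j : Fin (n + 1)) :
    y (Fin.last n) * blowUp n y j = y (Fin.last n) ^ (2 * (n + 1 - ((j : ℕ) + 1))) * y j := by
  by_cases h : j = Fin.last n
  · simp [blowUp, h]
  · have : (j : ℕ) < n := lt_of_le_of_ne (by have := j.2; omega) fun e => h (Fin.ext e)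
    rw [blowUp, if_neg h, ← mul_assoc, ← pow_succ']
    congr 2; omega

variable {A : Type*} [NormedCommRing A] [NormedAlgebra ℝ A]

theorem powerCoord_smul_of_eq_blowUp {n : ℕ} (ℓ : A →L[ℝ] ℝ) {y : Fin (n + 1) → ℝ}
    (hv : y (Fin.last n) ≠ 0) {W : A} (hW : IsUnit W) (h : powerCoord ℓ (n + 1) W = blowUp n y) :
    powerCoord ℓ (n + 1) (y (Fin.last n) • W) = y := by
  ext j
  have h1 := powerCoord_smul ℓ (n + 1) hv hW j
  rw [h, mul_blowUp] at h1
  exact mul_left_cancel₀ (pow_ne_zero _ hv) h1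

theorem eq_of_eqOn_of_mem_closure {E : Type*} [TopologicalSpace E] {f g : E → ℝ} {V : Set E} {x : E}
    (hf : ContinuousAt f x) (hg : ContinuousAt g x) (h : Set.EqOn f g V) (hx : x ∈ closure V) :
    f x = g x := by
  have := mem_closure_iff_nhdsWithin_neBot.1 hx
  refine tendsto_nhds_unique (hf.continuousWithinAt (s := V)) ?_
  exact (hg.continuousWithinAt (s := V)).tendsto.congr'
    (by filter_upwards [self_mem_nhdsWithin] with y hy using (h hy).symm)

theorem exists_nijenhuis_of_algebra [FiniteDimensional ℝ A] {n s : ℕ} (k : Fin s → ℕ)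
    (hsum : ∑ i, k i = n + 1) (χ : Fin s → A →ₐ[ℝ] ℝ)
    (hχ : ∀ Y : A, ∏ i, (Y - algebraMap ℝ A (χ i Y)) ^ k i = 0) (ℓ : A →L[ℝ] ℝ) {t : A}
    (ht : IsUnit t) (hinj : Function.Injective fun i => χ i t ^ 2)
    (hbase : powerCoord ℓ (n + 1) t = Pi.single (Fin.last n) 1)
    (hbij : Function.Bijective fun (u : A) (j : Fin (n + 1)) =>
      ℓ (Ring.inverse t ^ (2 * (n + 1 - ((j : ℕ) + 1))) * u)) :
    ∃ (U : Set (Fin (n + 1) → ℝ)) (L : (Fin (n + 1) → ℝ) → Matrix (Fin (n + 1)) (Fin (n + 1)) ℝ),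
      (0 : Fin (n + 1) → ℝ) ∈ U ∧ IsNijenhuisOn L U ∧ L 0 = nilpotentJordanBlock (n + 1) ∧
      (∀ x ∈ U, L x ∈ closure (regularLayer (n + 1) k) ∧
        L x ∈ zariskiClosure (regularLayer (n + 1) k)) ∧
      (∃ V : Set (Fin (n + 1) → ℝ), V ⊆ U ∧ IsOpen V ∧ U ⊆ closure V ∧
        ∀ x ∈ V, L x ∈ regularLayer (n + 1) k) := by
  have : CompleteSpace A := FiniteDimensional.complete ℝ A
  obtain ⟨Φ, hΦa, hΦt, hΦF⟩ := exists_analyticAt_inverse_powerCoord ℓ (n + 1) ht hbij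
  rw [hbase, ← blowUp_zero] at hΦa hΦt hΦF
  have hχc : ∀ i, Continuous (χ i) := fun i => (χ i).toLinearMap.continuous_of_finiteDimensional
  have hunit : ∀ᶠ w in 𝓝 (blowUp n 0), IsUnit (Φ w) := by
    refine hΦa.continuousAt (Units.isOpen.mem_nhds ?_)
    rw [hΦt]; exact ht
  have hdist : ∀ᶠ w in 𝓝 (blowUp n 0), Function.Injective fun i => χ i (Φ w) ^ 2 := by
    have : ∀ i j, i ≠ j → ∀ᶠ w in 𝓝 (blowUp n 0), χ i (Φ w) ^ 2 ≠ χ j (Φ w) ^ 2 := by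
      intro i j hij
      have hc : ∀ i, ContinuousAt (fun w => χ i (Φ w) ^ 2) (blowUp n 0) := fun i =>
        (((hχc i).continuousAt).comp hΦa.continuousAt).pow 2
      refine ((hc i).ne_iff_eventually_ne (hc j)).1 ?_
      rw [hΦt]; exact fun e => hij (hinj e)
    have h2 : ∀ᶠ w in 𝓝 (blowUp n 0), ∀ i j, i ≠ j → χ i (Φ w) ^ 2 ≠ χ j (Φ w) ^ 2 := by
      simp only [Filter.eventually_all]; exact this
    filter_upwards [h2] with w hw i j hij
    by_contra hne
    exact hw i j hne hij
  obtain ⟨N, hN, hNo, h0N⟩ := eventually_nhds_iff.1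
    (hΦa.eventually_analyticAt.and (hΦF.and (hunit.and hdist)))
  set U : Set (Fin (n + 1) → ℝ) := blowUp n ⁻¹' N with hU
  have hUo : IsOpen U := hNo.preimage
    (continuous_iff_continuousAt.2 fun y => (analyticAt_blowUp n y).continuousAt)
  set Y : (Fin (n + 1) → ℝ) → A := fun y => y (Fin.last n) • Φ (blowUp n y) with hY
  have hYa : AnalyticOnNhd ℝ Y U := fun y hy =>
    ((ContinuousLinearMap.proj (R := ℝ) (φ := fun _ : Fin (n + 1) => ℝ)
      (Fin.last n)).analyticAt y).smul ((hN _ hy).1.comp (analyticAt_blowUp n y))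
  set P : (Fin (n + 1) → ℝ) → ℝ[X] := fun y => ∏ i, (X - C (χ i (Y y ^ 2))) ^ k i with hP
  set b : (Fin (n + 1) → ℝ) → Fin (n + 1) → ℝ := fun y j => -(P y).coeff j with hb
  have hPm : ∀ y, (P y).Monic := fun y =>
    monic_prod_of_monic _ _ fun i _ => (monic_X_sub_C _).pow _
  have hPd : ∀ y, (P y).natDegree = n + 1 := fun y => by
    rw [hP, natDegree_prod_of_monic _ _ fun i _ => (monic_X_sub_C _).pow _]
    simpa only [natDegree_pow, natDegree_X_sub_C, mul_one] using hsum
  have hPb : ∀ y, monicOfTail (b y) = P y := fun y => monicOfTail_neg_coeff (hPm y) (hPd y)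
  have hba : AnalyticOnNhd ℝ b U := by
    rw [analyticOnNhd_pi_iff]
    intro j
    refine (analyticOnNhd_coeff_prod_X_sub_C_pow (fun i y hy => ?_) k j).neg
    exact ((χ i).toLinearMap.toContinuousLinearMap.analyticAt _).comp ((hYa y hy).pow 2)
  have hb0 : b 0 = 0 := by
    have hY0 : Y 0 = 0 := by simp [hY]
    ext j
    have : P 0 = X ^ (n + 1) := by
      simp only [hP, hY0, ne_eq, OfNat.ofNat_ne_zero, not_false_eq_true, zero_pow, map_zero,
        sub_zero, Finset.prod_pow_eq_pow_sum, hsum]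
    simp [hb, this, coeff_X_pow, j.2.ne]
  have hroot : ∀ y, aeval (Y y ^ 2) (monicOfTail (b y)) = 0 := by
    intro y
    rw [hPb, hP]
    rw [map_prod]
    refine (Finset.prod_congr rfl fun i _ => ?_).trans (hχ (Y y ^ 2))
    rw [map_pow, map_sub, aeval_X, aeval_C]
  set V : Set (Fin (n + 1) → ℝ) := U ∩ {y | y (Fin.last n) ≠ 0} with hV
  have hVo : IsOpen V := hUo.inter ((continuous_apply (Fin.last n)).isOpen_preimage _
    isOpen_compl_singleton)
  have hUV : U ⊆ closure V := by
    have hd : Dense {y : Fin (n + 1) → ℝ | y (Fin.last n) ≠ 0} :=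
      (dense_compl_singleton (0 : ℝ)).preimage (isOpenMap_eval (Fin.last n))
    exact hd.open_subset_closure_inter hUo
  have hreg : ∀ x ∈ V, rowCompanion (b x) ∈ regularLayer (n + 1) k := by
    intro x hx
    refine rowCompanion_mem_regularLayer k (b x) (fun i => χ i (Y x ^ 2)) ?_ (hPb x)
    intro i j hij
    refine (hN _ hx.1).2.2.2 ?_
    simpa [hY, mul_pow, hx.2.out] using hij
  -- `Y` is a unit only where `v ≠ 0`, so both identities are proved on `V` and extended to `U` by
  -- continuity.
  have hsymm : ∀ x ∈ U, (∀ a c, derivForm b x a c = derivForm b x c a) ∧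
      ∀ a c, derivForm b x (rowCompanion (b x) *ᵥ a) c =
        derivForm b x (rowCompanion (b x) *ᵥ c) a := by
    have hVs : ∀ x ∈ V, (∀ a c, derivForm b x a c = derivForm b x c a) ∧
      ∀ a c, derivForm b x (rowCompanion (b x) *ᵥ a) c =
        derivForm b x (rowCompanion (b x) *ᵥ c) a := by
      intro x hx
      have hux : IsUnit (Y x) := by
        have := ((IsUnit.mk0 _ hx.2.out).map (algebraMap ℝ A)).mul (hN _ hx.1).2.2.1
        rwa [← Algebra.smul_def] at this
      have hFx : ∀ᶠ y in 𝓝 x, powerCoord ℓ (n + 1) (Y y) = y := by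
        filter_upwards [hVo.mem_nhds hx] with y hy
        exact powerCoord_smul_of_eq_blowUp ℓ hy.2 (hN _ hy.1).2.2.1 (hN _ hy.1).2.1
      obtain ⟨M, hM⟩ := exists_derivForm_eq (hYa x hx.1).differentiableAt hux hFx
        (hba x hx.1).differentiableAt (Filter.Eventually.of_forall hroot)
      have h1 : ∀ a c, derivForm b x a c = derivForm b x c a := fun a c => by
        rw [(hM a c).1, (hM c a).1]; congr 1; ring
      refine ⟨h1, fun a c => ?_⟩
      rw [h1 _ c, h1 _ a, (hM c a).2, (hM a c).2]; congr 1; ring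
    have hfc : ∀ x ∈ U, ContinuousAt (fderiv ℝ b) x := fun x hx => (hba x hx).fderiv.continuousAt
    have hdot : ∀ (f : (Fin (n + 1) → ℝ) → Fin (n + 1) → ℝ) (c x : Fin (n + 1) → ℝ),
        ContinuousAt f x → ContinuousAt (fun y => f y ⬝ᵥ c) x := by
      intro f c x hf
      exact (Continuous.dotProduct continuous_id continuous_const).continuousAt.comp hf
    have hLc : ∀ a, ∀ x ∈ U, ContinuousAt (fun y => rowCompanion (b y) *ᵥ a) x := by
      intro a x hx
      simp only [rowCompanion_mulVec]
      exact continuousAt_const.add ((hdot b a x (hba x hx).continuousAt).smul continuousAt_const)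
    intro x hx
    refine ⟨fun a c => ?_, fun a c => ?_⟩
    · exact eq_of_eqOn_of_mem_closure (f := fun x => derivForm b x a c)
        (g := fun x => derivForm b x c a)
        (hdot _ _ _ ((hfc x hx).clm_apply continuousAt_const))
        (hdot _ _ _ ((hfc x hx).clm_apply continuousAt_const))
        (fun y hy => (hVs y hy).1 a c) (hUV hx)
    · exact eq_of_eqOn_of_mem_closure
        (f := fun x => derivForm b x (rowCompanion (b x) *ᵥ a) c)
        (g := fun x => derivForm b x (rowCompanion (b x) *ᵥ c) a)
        (hdot _ _ _ ((hfc x hx).clm_apply (hLc a x hx)))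
        (hdot _ _ _ ((hfc x hx).clm_apply (hLc c x hx)))
        (fun y hy => (hVs y hy).2 a c) (hUV hx)
  have hLa : ∀ i j, AnalyticOnNhd ℝ (fun x => rowCompanion (b x) i j) U := by
    intro i j
    simp only [rowCompanion_apply]
    refine analyticOnNhd_const.add ?_
    split_ifs
    · exact analyticOnNhd_pi_iff.1 hba j
    · exact analyticOnNhd_const
  have hcl : ∀ x ∈ U, rowCompanion (b x) ∈ closure (regularLayer (n + 1) k) := by
    intro x hx
    have hc : ContinuousAt (fun y => rowCompanion (b y)) x :=
      continuousAt_pi.2 fun i => continuousAt_pi.2 fun j => (hLa i j x hx).continuousAt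
    have hsub : (fun y => rowCompanion (b y)) '' V ⊆ regularLayer (n + 1) k :=
      Set.image_subset_iff.2 hreg
    exact closure_mono hsub (mem_closure_image hc (hUV hx))
  refine ⟨U, fun y => rowCompanion (b y), h0N, ⟨hUo, hLa, ?_⟩, ?_, fun x hx =>
    ⟨hcl x hx, closure_subset_zariskiClosure _ (hcl x hx)⟩,
    V, Set.inter_subset_left, hVo, hUV, hreg⟩
  · intro ξ η hξ hη x hx
    exact nijenhuisTorsion_rowCompanion (hba x hx).differentiableAt
      ((hξ.contDiffAt (hUo.mem_nhds hx)).differentiableAt (by simp))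
      ((hη.contDiffAt (hUo.mem_nhds hx)).differentiableAt (by simp))
      (hsymm x hx).1 (hsymm x hx).2
  · simp only [hb0, rowCompanion_zero]

end

/-! ### The model algebra -/

section
open Polynomial

/-- The norm on `A` is induced from matrices through the faithful left regular representation. -/
theorem exists_nijenhuis_of_finiteDimensional_algebra {A : Type*} [CommRing A] [Algebra ℝ A]
    [FiniteDimensional ℝ A] {n s : ℕ} (k : Fin s → ℕ)
    (hsum : ∑ i, k i = n + 1) (χ : Fin s → A →ₐ[ℝ] ℝ)
    (hχ : ∀ Y : A, ∏ i, (Y - algebraMap ℝ A (χ i Y)) ^ k i = 0) (ℓ : A →ₗ[ℝ] ℝ) {t : A}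
    (ht : IsUnit t) (hinj : Function.Injective fun i => χ i t ^ 2)
    (hbase : ∀ j : Fin (n + 1), ℓ (t * Ring.inverse t ^ (2 * (n + 1 - ((j : ℕ) + 1)))) =
      if j = Fin.last n then 1 else 0)
    (hbij : Function.Bijective fun (u : A) (j : Fin (n + 1)) =>
      ℓ (Ring.inverse t ^ (2 * (n + 1 - ((j : ℕ) + 1))) * u)) :
    ∃ (U : Set (Fin (n + 1) → ℝ)) (L : (Fin (n + 1) → ℝ) → Matrix (Fin (n + 1)) (Fin (n + 1)) ℝ),
      (0 : Fin (n + 1) → ℝ) ∈ U ∧ IsNijenhuisOn L U ∧ L 0 = nilpotentJordanBlock (n + 1) ∧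
      (∀ x ∈ U, L x ∈ closure (regularLayer (n + 1) k) ∧
        L x ∈ zariskiClosure (regularLayer (n + 1) k)) ∧
      (∃ V : Set (Fin (n + 1) → ℝ), V ⊆ U ∧ IsOpen V ∧ U ⊆ closure V ∧
        ∀ x ∈ V, L x ∈ regularLayer (n + 1) k) := by
  let := Matrix.linftyOpNormedRing (n := Fin (Module.finrank ℝ A)) (α := ℝ)
  let := Matrix.linftyOpNormedAlgebra (n := Fin (Module.finrank ℝ A)) (R := ℝ) (α := ℝ)
  let f := Algebra.leftMulMatrix (Module.finBasis ℝ A)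
  let : NormedCommRing A := NormedCommRing.induced A _ f (Algebra.leftMulMatrix_injective _)
  let : NormedAlgebra ℝ A := NormedAlgebra.induced ℝ A _ f
  refine exists_nijenhuis_of_algebra k hsum χ hχ ℓ.toContinuousLinearMap ht hinj ?_ hbij
  ext j
  rw [powerCoord, LinearMap.coe_toContinuousLinearMap', hbase, Pi.single_apply]
  split_ifs with h
  · simp [h]
  · simp

/-- The Hankel matrix of the last-coordinate functional in the basis of powers of `z` is
anti-triangular with ones on the antidiagonal. The coefficients of `u` thus vanish from the top
down. -/
theorem eq_zero_of_coord_last_pow_mul {A : Type*} [CommRing A] [Algebra ℝ A] {n : ℕ}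
    (e : Module.Basis (Fin (n + 1)) ℝ A) {z : A} (he : ∀ j, e j = z ^ (j : ℕ)) {u : A}
    (hu : ∀ j ≤ n, e.coord (Fin.last n) (z ^ j * u) = 0) : u = 0 := by
  have hc : ∀ j : Fin (n + 1), e.coord (Fin.last n) (z ^ (j : ℕ)) =
      if j = Fin.last n then 1 else 0 := by
    intro j
    rw [← he, Module.Basis.coord_apply, Module.Basis.repr_self, Finsupp.single_apply]
  have key : ∀ d ≤ n, ∀ m : Fin (n + 1), (m : ℕ) + d = n → e.repr u m = 0 := by
    intro d
    induction d using Nat.strong_induction_on with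
    | _ d ih =>
      intro hd m hm
      have h := hu d hd
      rw [← e.sum_repr u, Finset.mul_sum, map_sum, Finset.sum_eq_single m] at h
      · rw [he, mul_smul_comm, map_smul, ← pow_add] at h
        have := hc (Fin.last n)
        rw [Fin.val_last, if_pos rfl] at this
        rw [show d + (m : ℕ) = n by omega] at h
        rwa [this, smul_eq_mul, mul_one] at h
      · intro i _ hi
        rw [he, mul_smul_comm, map_smul, ← pow_add, smul_eq_mul]
        have hne : (i : ℕ) ≠ m := fun h => hi (Fin.ext h)
        rcases lt_or_gt_of_ne hne with hlt | hgt
        · have := hc ⟨d + i, by omega⟩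
          rw [if_neg (by intro h; have := congrArg Fin.val h; simp at this; omega)] at this
          rw [this, mul_zero]
        · rw [ih (n - i) (by omega) (by omega) i (by have := i.2; omega), zero_mul]
      · simp
  refine e.repr.map_eq_zero_iff.1 (Finsupp.ext fun m => ?_)
  exact key (n - m) (by omega) m (by have := m.2; omega)

/-- The polynomial `∏ i : Fin s, (X - C (i + 1)) ^ k i`. -/
noncomputable def modelPoly {s : ℕ} (k : Fin s → ℕ) : ℝ[X] :=
  ∏ i : Fin s, (X - C ((i : ℕ) + 1 : ℝ)) ^ k i

theorem modelPoly_monic {s : ℕ} (k : Fin s → ℕ) : (modelPoly k).Monic :=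
  monic_prod_of_monic _ _ fun _ _ => (monic_X_sub_C _).pow _

theorem modelPoly_natDegree {s : ℕ} (k : Fin s → ℕ) : (modelPoly k).natDegree = ∑ i, k i := by
  rw [modelPoly, natDegree_prod_of_monic _ _ fun i _ => (monic_X_sub_C _).pow _]
  simp only [natDegree_pow, natDegree_X_sub_C, mul_one]

theorem modelPoly_isCoprime {s : ℕ} (k : Fin s → ℕ) :
    IsCoprime (modelPoly k) ((modelPoly k).comp (-X)) := by
  simp only [modelPoly, prod_comp, pow_comp, sub_comp, X_comp, C_comp]
  refine IsCoprime.prod_left fun i _ => IsCoprime.prod_right fun j _ => IsCoprime.pow ?_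
  have hne : -((i : ℕ) + 1 : ℝ) - ((j : ℕ) + 1 : ℝ) ≠ 0 := by
    have : (0 : ℝ) < ((i : ℕ) + 1 : ℝ) + ((j : ℕ) + 1 : ℝ) := by positivity
    linarith
  refine ⟨C (-((i : ℕ) + 1 : ℝ) - ((j : ℕ) + 1 : ℝ))⁻¹,
    C (-((i : ℕ) + 1 : ℝ) - ((j : ℕ) + 1 : ℝ))⁻¹, ?_⟩
  rw [← mul_add]
  have : (X - C ((i : ℕ) + 1 : ℝ) + (-X - C ((j : ℕ) + 1 : ℝ))) =
      C (-((i : ℕ) + 1 : ℝ) - ((j : ℕ) + 1 : ℝ)) := by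
    simp only [C_sub, C_neg]; ring
  rw [this, ← C_mul, inv_mul_cancel₀ hne, C_1]

/-- `q(X²)` is even, so it is also divisible by the reflected polynomial. The roots of the two
factors have opposite signs, so the product divides `q(X²)`, and its degree is too large. Hence `t ^
2` still generates the model algebra. -/
theorem eq_zero_of_modelPoly_dvd_expand {s : ℕ} (k : Fin s → ℕ) {q : ℝ[X]}
    (h : modelPoly k ∣ expand ℝ 2 q) (hq : q.natDegree < (modelPoly k).natDegree) : q = 0 := by
  have h2 : (modelPoly k).comp (-X) ∣ expand ℝ 2 q := by
    obtain ⟨r, hr⟩ := h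
    refine ⟨r.comp (-X), ?_⟩
    rw [← mul_comp, ← hr, expand_eq_comp_X_pow, comp_assoc]
    simp
  have h3 := (modelPoly_isCoprime k).mul_dvd h h2
  by_contra hne
  have h4 := natDegree_le_of_dvd h3 ((expand_eq_zero (by norm_num)).not.2 hne)
  have hc : (modelPoly k).comp (-X) ≠ 0 := by
    intro h0
    have : ((modelPoly k).comp (-X)).comp (-X) = 0 := by rw [h0, zero_comp]
    rw [comp_assoc] at this
    simp [(modelPoly_monic k).ne_zero] at this
  rw [natDegree_mul (modelPoly_monic k).ne_zero hc, natDegree_comp, natDegree_neg, natDegree_X,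
    natDegree_expand] at h4
  omega

theorem linearIndependent_root_sq_pow {s n : ℕ} (k : Fin s → ℕ) (hsum : ∑ i, k i = n) :
    LinearIndependent ℝ fun j : Fin n => (AdjoinRoot.root (modelPoly k) ^ 2) ^ (j : ℕ) := by
  rw [Fintype.linearIndependent_iff]
  intro g hg
  set q : ℝ[X] := ∑ j, C (g j) * X ^ (j : ℕ) with hqdef
  have hcoef : ∀ j : Fin n, q.coeff j = g j := by
    intro j
    simp [hqdef, finsetSum_coeff, coeff_C_mul, coeff_X_pow, Fin.val_inj]
  have hdvd : modelPoly k ∣ expand ℝ 2 q := by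
    rw [← AdjoinRoot.mk_eq_zero, ← hg, hqdef, map_sum, map_sum]
    refine Finset.sum_congr rfl fun j _ => ?_
    simp [Algebra.smul_def, AdjoinRoot.algebraMap_eq]
  have hq0 : q = 0 := by
    by_cases h0 : q = 0
    · exact h0
    refine eq_zero_of_modelPoly_dvd_expand k hdvd ?_
    rw [modelPoly_natDegree, hsum, natDegree_lt_iff_degree_lt h0]
    exact monicOfTail_degree_tail g
  intro j
  rw [← hcoef, hq0, coeff_zero]

theorem isUnit_root_modelPoly {s : ℕ} (k : Fin s → ℕ) :
    IsUnit (AdjoinRoot.root (modelPoly k)) := by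
  have h0 : (modelPoly k).coeff 0 ≠ 0 := by
    rw [coeff_zero_eq_eval_zero, modelPoly, eval_prod, Finset.prod_ne_zero_iff]
    intro i _
    have : (0 : ℝ) < ((i : ℕ) + 1 : ℝ) := by positivity
    simp only [eval_pow, eval_sub, eval_X, eval_C]
    exact pow_ne_zero _ (by linarith)
  have h1 := congrArg (AdjoinRoot.mk (modelPoly k)) (divX_mul_X_add (modelPoly k))
  rw [AdjoinRoot.mk_self, map_add, map_mul, AdjoinRoot.mk_X, AdjoinRoot.mk_C,
    add_eq_zero_iff_eq_neg] at h1
  refine isUnit_of_mul_isUnit_right (x := AdjoinRoot.mk (modelPoly k) (modelPoly k).divX) ?_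
  rw [h1, IsUnit.neg_iff]
  exact (IsUnit.mk0 _ h0).map _

theorem exists_nijenhuis_succ {n s : ℕ} (k : Fin s → ℕ) (hk : ∀ i, 1 ≤ k i)
    (hsum : ∑ i, k i = n + 1) :
    ∃ (U : Set (Fin (n + 1) → ℝ)) (L : (Fin (n + 1) → ℝ) → Matrix (Fin (n + 1)) (Fin (n + 1)) ℝ),
      (0 : Fin (n + 1) → ℝ) ∈ U ∧ IsNijenhuisOn L U ∧ L 0 = nilpotentJordanBlock (n + 1) ∧
      (∀ x ∈ U, L x ∈ closure (regularLayer (n + 1) k) ∧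
        L x ∈ zariskiClosure (regularLayer (n + 1) k)) ∧
      (∃ V : Set (Fin (n + 1) → ℝ), V ⊆ U ∧ IsOpen V ∧ U ⊆ closure V ∧
        ∀ x ∈ V, L x ∈ regularLayer (n + 1) k) := by
  have hm := modelPoly_monic k
  have hfin : FiniteDimensional ℝ (AdjoinRoot (modelPoly k)) := hm.finite_adjoinRoot
  have hrank : Module.finrank ℝ (AdjoinRoot (modelPoly k)) = n + 1 := by
    rw [(AdjoinRoot.powerBasis' hm).finrank, AdjoinRoot.powerBasis'_dim, modelPoly_natDegree, hsum]
  set t := AdjoinRoot.root (modelPoly k) with ht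
  let e : Module.Basis (Fin (n + 1)) ℝ (AdjoinRoot (modelPoly k)) :=
    basisOfLinearIndependentOfCardEqFinrank (linearIndependent_root_sq_pow k hsum) (by simp [hrank])
  have he : ∀ j, e j = (t ^ 2) ^ (j : ℕ) := fun j => by simp [e, ht]
  have htu : IsUnit t := isUnit_root_modelPoly k
  have hinv : t * Ring.inverse t = 1 := Ring.mul_inverse_cancel _ htu
  have heval : ∀ i : Fin s, (modelPoly k).eval₂ (algebraMap ℝ ℝ) ((i : ℕ) + 1 : ℝ) = 0 := by
    intro i
    rw [modelPoly, eval₂_finsetProd]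
    refine Finset.prod_eq_zero (Finset.mem_univ i) ?_
    have := hk i
    simp [zero_pow (show k i ≠ 0 by omega)]
  let χ : Fin s → AdjoinRoot (modelPoly k) →ₐ[ℝ] ℝ := fun i =>
    AdjoinRoot.liftAlgHom (modelPoly k) (Algebra.ofId ℝ ℝ) ((i : ℕ) + 1 : ℝ) (heval i)
  have hχmk : ∀ (i : Fin s) (q : ℝ[X]), χ i (AdjoinRoot.mk _ q) = q.eval ((i : ℕ) + 1 : ℝ) := by
    intro i q
    simp [χ, eval₂_eq_eval_map]
  -- Twisting the top coordinate by `t ^ (2 n - 1)` turns `ℓ (t ^ (-2 e) u)` into the top coordinate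
  -- of `t ^ (2 j) · t⁻¹ u`. At `u = t` this is the base point `e_last`, and for general `u` it is
  -- the nondegenerate Hankel pairing.
  let ℓ : AdjoinRoot (modelPoly k) →ₗ[ℝ] ℝ :=
    (e.coord (Fin.last n)).comp (LinearMap.mulLeft ℝ (Ring.inverse t * (t ^ 2) ^ n))
  have hℓ : ∀ (j : Fin (n + 1)) u, ℓ (Ring.inverse t ^ (2 * (n + 1 - ((j : ℕ) + 1))) * u) =
      e.coord (Fin.last n) ((t ^ 2) ^ (j : ℕ) * (Ring.inverse t * u)) := by
    intro j u
    have h1 : n = j + (n + 1 - ((j : ℕ) + 1)) := by have := j.2; omega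
    have h2 : (t ^ 2) ^ n * Ring.inverse t ^ (2 * (n + 1 - ((j : ℕ) + 1))) = (t ^ 2) ^ (j : ℕ) := by
      conv_lhs => rw [show (t ^ 2) ^ n = (t ^ 2) ^ (j + (n + 1 - ((j : ℕ) + 1))) by rw [← h1]]
      rw [pow_add, pow_mul, mul_assoc, ← mul_pow, ← mul_pow, hinv, one_pow, one_pow, mul_one]
    simp only [ℓ, LinearMap.comp_apply, LinearMap.mulLeft_apply]
    congr 1
    linear_combination (Ring.inverse t * u) * h2
  refine exists_nijenhuis_of_finiteDimensional_algebra k hsum χ ?_ ℓ htu ?_ ?_ ?_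
  · intro Y
    obtain ⟨q, rfl⟩ := AdjoinRoot.mk_surjective Y
    simp only [hχmk]
    have : ∏ i : Fin s, (AdjoinRoot.mk (modelPoly k) q -
        algebraMap ℝ (AdjoinRoot (modelPoly k)) (q.eval ((i : ℕ) + 1 : ℝ))) ^ k i =
        AdjoinRoot.mk (modelPoly k) (∏ i : Fin s, (q - C (q.eval ((i : ℕ) + 1 : ℝ))) ^ k i) := by
      simp [map_prod, AdjoinRoot.algebraMap_eq]
    rw [this, AdjoinRoot.mk_eq_zero]
    -- `X - a` divides `q - q(a)`, factor by factor.
    exact Finset.prod_dvd_prod_of_dvd _ _ fun i _ => pow_dvd_pow_of_dvd X_sub_C_dvd_sub_C_eval _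
  · have hroot : ∀ i : Fin s, χ i t = (i : ℕ) + 1 := fun i => by
      rw [ht, ← AdjoinRoot.mk_X, hχmk, eval_X]
    intro i j hij
    simp only [hroot] at hij
    have := (sq_eq_sq₀ (by positivity) (by positivity)).1 hij
    exact Fin.ext (by exact_mod_cast add_right_cancel this)
  · intro j
    rw [mul_comm, hℓ, mul_comm (Ring.inverse t), hinv, mul_one, ← he, Module.Basis.coord_apply,
      Module.Basis.repr_self, Finsupp.single_apply]
  · simp only [hℓ]
    let D : AdjoinRoot (modelPoly k) →ₗ[ℝ] (Fin (n + 1) → ℝ) := LinearMap.pi fun j =>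
      (e.coord (Fin.last n)).comp (LinearMap.mulLeft ℝ ((t ^ 2) ^ (j : ℕ) * Ring.inverse t))
    have hD : (fun u (j : Fin (n + 1)) =>
        e.coord (Fin.last n) ((t ^ 2) ^ (j : ℕ) * (Ring.inverse t * u))) = D := by
      ext u j; simp [D]
    rw [hD]
    have hinjD : Function.Injective D := by
      rw [injective_iff_map_eq_zero]
      intro u hu
      have h0 := eq_zero_of_coord_last_pow_mul e he (u := Ring.inverse t * u) fun j hj => by
        have := congrFun ((congrFun hD u).trans hu) ⟨j, by omega⟩
        simpa using this
      have := congrArg (t * ·) h0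
      simpa [← mul_assoc, hinv] using this
    exact ⟨hinjD, (LinearMap.injective_iff_surjective_of_finrank_eq_finrank
      (by rw [hrank]; simp)).1 hinjD⟩

end

theorem theorem4 (n s : ℕ) (k : Fin s → ℕ) (hk : ∀ i, 1 ≤ k i) (hsum : ∑ i, k i = n) :
    ∃ (U : Set (Fin n → ℝ)) (L : (Fin n → ℝ) → Matrix (Fin n) (Fin n) ℝ),
      (0 : Fin n → ℝ) ∈ U ∧ IsNijenhuisOn L U ∧ L 0 = nilpotentJordanBlock n ∧
      (∀ x ∈ U, L x ∈ closure (regularLayer n k) ∧ L x ∈ zariskiClosure (regularLayer n k)) ∧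
      (∃ V : Set (Fin n → ℝ), V ⊆ U ∧ IsOpen V ∧ U ⊆ closure V ∧
        ∀ x ∈ V, L x ∈ regularLayer n k) := by
  rcases n with _ | n
  -- For `n = 0`, positivity of the `k i` forces `s = 0`, and the empty matrix lies in the layer.
  · have hs : IsEmpty (Fin s) := ⟨fun i => by
      have h1 := hk i
      have h2 := Finset.sum_eq_zero_iff.1 hsum i (Finset.mem_univ i)
      omega⟩
    have hmem : ∀ M : Matrix (Fin 0) (Fin 0) ℝ, M ∈ regularLayer 0 k := fun M =>
      ⟨by rw [IsGlRegular, minpoly.subsingleton, Matrix.charpoly, Matrix.det_isEmpty],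
        isEmptyElim, fun i => isEmptyElim i, by simp⟩
    exact ⟨Set.univ, fun _ => 0, Set.mem_univ _,
      ⟨isOpen_univ, fun i => i.elim0, fun _ _ _ _ _ _ => Subsingleton.elim _ _⟩,
      Subsingleton.elim _ _, fun x _ => ⟨subset_closure (hmem _), fun p hp => hp _ (hmem _)⟩,
      Set.univ, subset_rfl, isOpen_univ, by simp, fun x _ => hmem _⟩
  · exact exists_nijenhuis_succ k hk hsum
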